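/- Let $k$ be an algebraically closed field. An algebraic semigroup is a reduced separated scheme $S$ of finite type over $k$ (not necessarily irreducible) with an associative morphism of $k$-schemes $\mu : S \times_k S \to S$, written $(x,y) \mapsto xy$; by a point of $S$ we mean a $k$-rational point. The scheme of idempotents $E(S)$ is the scheme-theoretic preimage of the diagonal of $S \times_k S$ under the morphism $S \to S \times_k S$, $x \mapsto (x^2, x)$; its $k$-rational points are the idempotents of $S$, that is, the points $e$ of $S$ with $e^2 = e$. An idempotent $e$ is called isolated if it is an isolated point of the topological space $E(S)$, and central if $ex = xe$ for every point $x$ of $S$. Let $S$ be an algebraic semigroup, let $e$ be an idempotent of $S$, and let $C = C(e)$ be the union of those irreducible components of $S$ that contain $e$. Then $e$ is isolated in $E(S)$ if and only if $e$ centralizes $C$, that is, $ex = xe$ for every point $x$ of $C$; in that case the scheme $E(S)$ is reduced at $e$, that is, the local ring $\mathcal{O}_{E(S),e}$ is reduced. In particular, if $S$ is irreducible, then the isolated idempotents of $S$ are exactly its central idempotents. -/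

import Mathlib

open CategoryTheory AlgebraicGeometry MonoidalCategory CartesianMonoidalCategory

universe u

noncomputable section

/-- An algebraic semigroup over `k`: a variety over `k`, i.e. a reduced, separated scheme of finite
type over `k` (not necessarily irreducible), with an associative morphism of `k`-schemes
`mul : S ×ₖ S ⟶ S`. -/
structure AlgebraicSemigroup (k : Type u) [Field k] where
  /-- The underlying `k`-scheme. -/
  X : Over (Spec (.of k))
  isReduced : IsReduced X.left
  isSeparated : IsSeparated X.hom
  locallyOfFiniteType : LocallyOfFiniteType X.hom
  quasiCompact : QuasiCompact X.hom
  /-- The composition law; `X ⊗ X` is the fibre product over `Spec k`. -/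
  mul : X ⊗ X ⟶ X
  assoc : (mul ▷ X) ≫ mul = (α_ X X X).hom ≫ (X ◁ mul) ≫ mul

namespace AlgebraicSemigroup

variable {k : Type u} [Field k] (S : AlgebraicSemigroup k)

/-- The (`k`-rational) points of `S`: morphisms of `k`-schemes `Spec k ⟶ S`. -/
@[ext]
structure Point where
  /-- The morphism `Spec k ⟶ S` over `Spec k`. -/
  hom : 𝟙_ (Over (Spec (.of k))) ⟶ S.X

/-- The composition law on points, `xy = mul (x, y)`. -/
instance : Mul S.Point := ⟨fun x y ↦ ⟨lift x.hom y.hom ≫ S.mul⟩⟩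

@[simp]
theorem point_mul_hom (x y : S.Point) : (x * y).hom = lift x.hom y.hom ≫ S.mul := rfl

instance : Semigroup S.Point where
  mul_assoc x y z := by
    have h := congrArg (fun t ↦ lift (lift x.hom y.hom) z.hom ≫ t) S.assoc
    ext1
    simpa using h

variable {S} in
/-- The morphism of schemes `Spec k ⟶ S` underlying a point of `S`. -/
def Point.left (x : S.Point) : Spec (.of k) ⟶ S.X.left := x.hom.left

variable {S} in
/-- The element of the underlying topological space of `S` given by a point of `S`. -/
def Point.toSpace (x : S.Point) : S.X.left := x.left (IsLocalRing.closedPoint k)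

/-- The square map `x ↦ x²` of `S`. -/
def sq : S.X ⟶ S.X := lift (𝟙 S.X) (𝟙 S.X) ≫ S.mul

/-- The scheme of idempotents `E(S)`: the scheme-theoretic preimage of the diagonal of `S ×ₖ S`
under the morphism `S ⟶ S ×ₖ S`, `x ↦ (x², x)`. -/
def E : Scheme.{u} :=
  Limits.pullback (lift S.sq (𝟙 S.X)).left (lift (𝟙 S.X) (𝟙 S.X)).left

/-- The inclusion of `E(S)` in `S`. -/
def ιE : S.E ⟶ S.X.left := Limits.pullback.fst _ _

variable {S}

/-- The `k`-rational point of `E(S)` defined by an idempotent `e` of `S`. -/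
def idempotentPoint (e : S.Point) (he : IsIdempotentElem e) : Spec (.of k) ⟶ S.E :=
  Limits.pullback.lift e.left e.left (by
    have h : lift e.hom e.hom ≫ S.mul = e.hom := congrArg Point.hom he
    have h' : e.hom ≫ lift S.sq (𝟙 S.X) = e.hom ≫ lift (𝟙 S.X) (𝟙 S.X) := by
      rw [comp_lift, comp_lift, sq, comp_lift_assoc, Category.comp_id, h]
    exact congrArg (fun t ↦ t.left) h')

/-- An idempotent `e` of `S`, as an element of the underlying topological space of `E(S)`. -/
def toE (e : S.Point) (he : IsIdempotentElem e) : S.E :=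
  idempotentPoint e he (IsLocalRing.closedPoint k)

theorem ιE_toE (e : S.Point) (he : IsIdempotentElem e) : S.ιE (toE e he) = e.toSpace := by
  have h : idempotentPoint e he ≫ S.ιE = e.left := Limits.pullback.lift_fst _ _ _
  exact congrArg (fun t : Spec (.of k) ⟶ S.X.left ↦ t (IsLocalRing.closedPoint k)) h

/-- The idempotent `e` is an isolated point of the topological space `E(S)`. -/
def IsIsolated (e : S.Point) (he : IsIdempotentElem e) : Prop :=
  IsOpen ({toE e he} : Set S.E)

/-- The scheme `E(S)` is reduced at `e`: its local ring at `e` is reduced. -/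
def IsReducedAt (e : S.Point) (he : IsIdempotentElem e) : Prop :=
  _root_.IsReduced (S.E.presheaf.stalk (toE e he))

/-- The points of `S` that lie on some irreducible component of `S` through `e`, i.e. the points of
the union `C(e)` of these components. -/
def C (e : S.Point) : Set S.Point :=
  {x | ∃ Z ∈ irreducibleComponents S.X.left, e.toSpace ∈ Z ∧ x.toSpace ∈ Z}

end AlgebraicSemigroup

end

/-!
The Zariski topology makes the set of `k`-rational points of `S` a semigroup with separately
continuous multiplication.

*Isolated idempotents centralize `C(e)`.* Let `e` be isolated in `E(S)` and let `Z` be an irreducible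
component of `S` through `e`. The irreducible set `Ze` is contained in a maximal irreducible subset
`W` of `Se`. As `e` is a right identity of `Se`, the irreducible set `WW` contains `We = W`, so that
`WW = W` and `eW ⊆ W`. Left multiplication by `e` is thus an idempotent endomorphism of `W`. Its
fibre over `e` consists of idempotents, because `y ∈ Se` and `ey = e` give
`y² = (ye)y = y(ey) = ye = y`; hence `e` is isolated in that fibre. By the inequality between the
dimensions of source, target and fibre, the image of `W` has the same dimension as `W` and is dense
in `W`; as `e` acts as the identity on this image, it does so on `W`
(`IsLocalRing.comap_eq_of_le_comap_of_fiber`,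
`AlgebraicGeometry.Scheme.apply_eq_of_isolated_fiber`). In particular `exe = xe` for `x ∈ Z`
(`AlgebraicGeometry.Scheme.mul_right_eq_mul_mul_of_isolated`). The opposite semigroup gives
`exe = ex`.

*Idempotents centralizing `C(e)` are isolated and reduced.* In this case `ex = xe` as morphisms on a
neighbourhood of `e`. Let `x` be a tangent vector of `E(S)` at `e`. The differential of the
multiplication at `(e, e)` is `(v, w) ↦ v e + e w` (`AlgebraicSemigroup.stalk_mul_self`), so `x² = x`
and `ex = xe` read `x = 2 ex` in the tangent space; applied to the idempotent tangent vector `ex`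
this gives `ex = 2 ex`, that is, `ex = 0`, and so `x = 0`
(`AlgebraicSemigroup.eq_const_of_idempotent`). The tangent space of `E(S)` at `e` being zero, the
local ring of `E(S)` at `e` is a field (`AlgebraicSemigroup.maximalIdeal_stalk_E_eq_bot`), and the
closed point `e` is open in the Noetherian space `E(S)`.
-/

noncomputable section

/-! ### Local endomorphisms with zero-dimensional closed fibre -/

/-- Let `φ` be a local endomorphism of a Noetherian local ring `R`, and let `p` be a prime with
`p ≤ φ⁻¹(p)`. If the closed fibre of the map `R ⧸ φ⁻¹(p) → R ⧸ p` induced by `φ` is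
zero-dimensional, then `dim (R ⧸ p) ≤ dim (R ⧸ φ⁻¹(p))`. As a proper quotient of the local domain
`R ⧸ p` has smaller dimension, `φ⁻¹(p) = p`. Geometrically: an endomorphism that maps an irreducible
germ into itself with an isolated closed fibre is dominant on that germ. -/
theorem IsLocalRing.comap_eq_of_le_comap_of_fiber {R : Type*} [CommRing R] [IsLocalRing R]
    [IsNoetherianRing R] (φ : R →+* R) [IsLocalHom φ]
    (p : Ideal R) [p.IsPrime] (hp : p ≤ p.comap φ)
    (hfib : ∀ q : Ideal R, q.IsPrime → p ≤ q → (maximalIdeal R).map φ ≤ q → q = maximalIdeal R) :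
    p.comap φ = p := by
  set q := p.comap φ
  have hqp : q.IsPrime := inferInstance
  refine le_antisymm ?_ hp
  by_contra hlt
  obtain ⟨r, hrq, hrp⟩ := SetLike.not_le_iff_exists.mp hlt
  let A := R ⧸ q
  let B := R ⧸ p
  let ψ : A →+* B := Ideal.quotientMap p φ le_rfl
  let : Algebra A B := ψ.toAlgebra
  have : IsLocalRing A := .of_surjective' _ Ideal.Quotient.mk_surjective
  have : IsLocalRing B := .of_surjective' _ Ideal.Quotient.mk_surjective
  have hmA : (maximalIdeal A).comap (Ideal.Quotient.mk q) = maximalIdeal R :=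
    IsLocalRing.eq_maximalIdeal (Ideal.comap_isMaximal_of_surjective _ Ideal.Quotient.mk_surjective)
  have hmB : (maximalIdeal B).comap (Ideal.Quotient.mk p) = maximalIdeal R :=
    IsLocalRing.eq_maximalIdeal (Ideal.comap_isMaximal_of_surjective _ Ideal.Quotient.mk_surjective)
  have hover : (maximalIdeal B).LiesOver (maximalIdeal A) := by
    refine ⟨?_⟩
    apply Ideal.comap_injective_of_surjective _ (Ideal.Quotient.mk_surjective (I := q))
    rw [hmA, Ideal.under_def, Ideal.comap_comap,
      show (algebraMap A B).comp (Ideal.Quotient.mk q) = (Ideal.Quotient.mk p).comp φ from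
        Ideal.quotientMap_comp_mk _, ← Ideal.comap_comap, hmB]
    exact (IsLocalRing.maximalIdeal_comap φ).symm
  -- The dimension of `B` is at most that of `A` plus that of the closed fibre.
  have h1 := Ideal.height_le_height_add_of_liesOver (maximalIdeal A) (maximalIdeal B)
  have h2 : ((maximalIdeal B).map
      (Ideal.Quotient.mk <| (maximalIdeal A).map (algebraMap A B))).height = 0 := by
    have hle : (maximalIdeal A).map (algebraMap A B) ≤ maximalIdeal B :=
      Ideal.map_le_iff_le_comap.mpr hover.over.le
    have := Ideal.isPrime_map_quotientMk_of_isPrime hle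
    rw [Ideal.height_eq_zero_iff]
    refine ⟨⟨this, bot_le⟩, fun J ⟨hJ, _⟩ hJle ↦ ?_⟩
    rw [Ideal.map_le_iff_le_comap]
    have key := hfib ((J.comap (Ideal.Quotient.mk _)).comap (Ideal.Quotient.mk p))
      inferInstance ?_ ?_
    · rw [← hmB] at key
      exact (Ideal.comap_injective_of_surjective _ (Ideal.Quotient.mk_surjective (I := p)) key).ge
    · intro x hx
      simp [Ideal.mem_comap, Ideal.Quotient.eq_zero_iff_mem.mpr hx]
    · rw [Ideal.map_le_iff_le_comap]
      intro x hx
      have : Ideal.Quotient.mk p (φ x) = algebraMap A B (Ideal.Quotient.mk q x) := rfl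
      rw [Ideal.mem_comap, Ideal.mem_comap, Ideal.mem_comap, this,
        Ideal.Quotient.eq_zero_iff_mem.mpr]
      · exact J.zero_mem
      · refine Ideal.mem_map_of_mem _ ?_
        rw [← hmA] at hx
        exact hx
  rw [h2, add_zero] at h1
  have h3 : ringKrullDim B ≤ ringKrullDim A := by
    rw [← IsLocalRing.maximalIdeal_height_eq_ringKrullDim,
      ← IsLocalRing.maximalIdeal_height_eq_ringKrullDim]
    exact_mod_cast h1
  -- The element `r` is nonzero in the domain `B` and vanishes in its quotient `A`.
  have h4 := ringKrullDim_quotient_succ_le_of_nonZeroDivisor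
    (mem_nonZeroDivisors_of_ne_zero (x := Ideal.Quotient.mk p r)
      (mt (Ideal.Quotient.eq_zero_iff_mem (I := p)).mp hrp))
  have h5 : ringKrullDim A ≤
      ringKrullDim (B ⧸ Ideal.span {Ideal.Quotient.mk p r}) := by
    refine ringKrullDim_le_of_surjective (Ideal.Quotient.lift _ (Ideal.Quotient.factor hp) ?_) ?_
    · intro a ha
      refine (Ideal.span_le (I := RingHom.ker (Ideal.Quotient.factor hp))).mpr ?_ ha
      simpa [RingHom.mem_ker] using Ideal.Quotient.eq_zero_iff_mem.mpr hrq
    · exact Ideal.Quotient.lift_surjective_of_surjective _ _ (Ideal.Quotient.factor_surjective hp)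
  have h6 : ringKrullDim A + 1 ≤ ringKrullDim A :=
    (add_le_add_left h5 1).trans (h4.trans h3)
  have h7 : maximalIdeal A ≠ ⊤ := Ideal.IsPrime.ne_top'
  have h8 := Ideal.height_ne_top h7
  rw [← IsLocalRing.maximalIdeal_height_eq_ringKrullDim] at h6
  have h9 : (maximalIdeal A).height + 1 ≤ (maximalIdeal A).height := by exact_mod_cast h6
  exact absurd h9 (not_le.mpr (ENat.lt_add_one_iff h8 |>.mpr le_rfl))

/-! ### Irreducible sets, in general and under separately continuous multiplication -/

/-- Separate continuity is enough for a product of irreducible sets to be irreducible; this is what is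
needed for the Zariski topology, in which the multiplication is not jointly continuous for the
product topology. -/
theorem IsPreirreducible.mul {M : Type*} [TopologicalSpace M] [Mul M] [SeparatelyContinuousMul M]
    {s t : Set M} (hs : IsPreirreducible s) (ht : IsPreirreducible t) :
    IsPreirreducible (Set.image2 (· * ·) s t) := by
  rintro u v hu hv ⟨_, ⟨a₁, ha₁, b₁, hb₁, rfl⟩, h₁⟩ ⟨_, ⟨a₂, ha₂, b₂, hb₂, rfl⟩, h₂⟩
  obtain ⟨a, ha, hau, hav⟩ := hs _ _
    (hu.preimage (SeparatelyContinuousMul.continuous_mul_const (a := b₁)))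
    (hv.preimage (SeparatelyContinuousMul.continuous_mul_const (a := b₂)))
    ⟨a₁, ha₁, h₁⟩ ⟨a₂, ha₂, h₂⟩
  obtain ⟨b, hb, hbu, hbv⟩ := ht _ _
    (hu.preimage (SeparatelyContinuousMul.continuous_const_mul (a := a)))
    (hv.preimage (SeparatelyContinuousMul.continuous_const_mul (a := a)))
    ⟨b₁, hb₁, hau⟩ ⟨b₂, hb₂, hav⟩
  exact ⟨a * b, ⟨a, ha, b, hb, rfl⟩, hbu, hbv⟩

/-- A maximal irreducible set `t ∋ e` satisfies `t * t = t`, as `t * t` is irreducible and contains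
`t * e = t`. -/
theorem IsPreirreducible.exists_superset_mul_mem {M : Type*} [TopologicalSpace M] [Mul M]
    [SeparatelyContinuousMul M] {e : M} (he : ∀ x : M, x * e = x) {s : Set M}
    (hs : IsPreirreducible s) (hes : e ∈ s) :
    ∃ t, IsPreirreducible t ∧ s ⊆ t ∧ ∀ x ∈ t, e * x ∈ t := by
  obtain ⟨t, ht, hst, hmax⟩ := exists_preirreducible s hs
  have htt := hmax _ (ht.mul ht) fun x hx ↦ ⟨x, hx, e, hst hes, he x⟩
  exact ⟨t, ht, hst, fun x hx ↦ htt ▸ ⟨e, hst hes, x, hx, rfl⟩⟩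

theorem IsPreirreducible.preimage_of_range_eq_closedPoints {P X : Type*} [TopologicalSpace P]
    [TopologicalSpace X] [JacobsonSpace X] {t : P → X} (ht : Topology.IsInducing t)
    (htr : Set.range t = closedPoints X) {Z : Set X} (hZ : IsPreirreducible Z)
    (hZc : IsClosed Z) : IsPreirreducible (t ⁻¹' Z) := by
  rintro u v hu hv ⟨x, hxZ, hxu⟩ ⟨y, hyZ, hyv⟩
  obtain ⟨u, hu', rfl⟩ := ht.isOpen_iff.mp hu
  obtain ⟨v, hv', rfl⟩ := ht.isOpen_iff.mp hv
  obtain ⟨z, hz, hzc⟩ := nonempty_inter_closedPoints (hZ u v hu' hv' ⟨_, hxZ, hxu⟩ ⟨_, hyZ, hyv⟩)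
    (hZc.isLocallyClosed.inter (hu'.inter hv').isLocallyClosed)
  obtain ⟨z, rfl⟩ := htr.ge hzc
  exact ⟨z, hz⟩

/-- The complement of the union of the irreducible components that do not contain `x`. -/
theorem exists_isOpen_forall_mem_irreducibleComponents {X : Type*} [TopologicalSpace X]
    [TopologicalSpace.NoetherianSpace X] (x : X) : ∃ U : Set X, IsOpen U ∧ x ∈ U ∧
      ∀ y ∈ U, ∀ Z ∈ irreducibleComponents X, y ∈ Z → x ∈ Z := by
  have hfin : {Z ∈ irreducibleComponents X | x ∉ Z}.Finite :=
    TopologicalSpace.NoetherianSpace.finite_irreducibleComponents.subset fun Z hZ ↦ hZ.1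
  refine ⟨(⋃₀ {Z ∈ irreducibleComponents X | x ∉ Z})ᶜ, ?_, ?_, fun y hy Z hZ hyZ ↦ ?_⟩
  · rw [Set.sUnion_eq_biUnion, isOpen_compl_iff]
    exact hfin.isClosed_biUnion fun Z hZ ↦ isClosed_of_mem_irreducibleComponents Z hZ.1
  · rintro ⟨Z, hZ, hxZ⟩
    exact hZ.2 hxZ
  · by_contra hxZ
    exact hy ⟨Z, ⟨hZ, hxZ⟩, hyZ⟩

/-! ### Endomorphisms of schemes with an isolated fibre -/

namespace AlgebraicGeometry.Scheme

/-- A form of `SpecToEquivOfLocalRing` in which the image `x` of the closed point is given up to a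
propositional equality only. -/
theorem exists_isLocalHom_SpecMap_fromSpecStalk {X : Scheme.{u}} {B : CommRingCat.{u}}
    [IsLocalRing B] (g : Spec B ⟶ X) {x : X} (hx : g (IsLocalRing.closedPoint B) = x) :
    ∃ φ : X.presheaf.stalk x ⟶ B, IsLocalHom φ.hom ∧ Spec.map φ ≫ X.fromSpecStalk x = g := by
  subst hx
  exact ⟨stalkClosedPointTo g, inferInstance, Spec_stalkClosedPointTo_fromSpecStalk g⟩

/-- If an endomorphism `f` of `X` maps the closure of `w` into itself and `e` is isolated in the
fibre of `f` over `e` in this closure, then `f` fixes `w`. This is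
`IsLocalRing.comap_eq_of_le_comap_of_fiber` for the local ring at `e`. -/
theorem apply_eq_of_isolated_fiber {X : Scheme.{u}} [IsLocallyNoetherian X] (f : X ⟶ X)
    {e w : X} (he : f e = e) (hwf : w ⤳ f w) (hfwe : f w ⤳ e)
    (hfib : ∀ y : X, w ⤳ y → y ⤳ e → f y = e → y = e) : f w = w := by
  obtain ⟨φ, hφl, hφ⟩ := exists_isLocalHom_SpecMap_fromSpecStalk (X.fromSpecStalk e ≫ f) (x := e)
    ((congrArg f fromSpecStalk_closedPoint).trans he)
  have happ (p : Spec (X.presheaf.stalk e)) :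
      f (X.fromSpecStalk e p) = X.fromSpecStalk e (Spec.map φ p) := by
    rw [← Scheme.Hom.comp_apply, ← hφ, Scheme.Hom.comp_apply]
  obtain ⟨p, hp⟩ : w ∈ Set.range (X.fromSpecStalk e) := by
    rw [range_fromSpecStalk]; exact hwf.trans hfwe
  have hemb := (X.fromSpecStalk e).isEmbedding
  have hpp : p ⤳ Spec.map φ p := by
    rw [← hemb.isInducing.specializes_iff, ← happ, hp]
    exact hwf
  have := PrimeSpectrum.isPrime p
  have hcomap := IsLocalRing.comap_eq_of_le_comap_of_fiber φ.hom p.asIdeal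
    ((PrimeSpectrum.le_iff_specializes _ _).mpr hpp) ?_
  · have : Spec.map φ p = p := PrimeSpectrum.ext hcomap
    rw [← hp, happ, this]
  · intro q hq hpq hmq
    let q' : Spec (X.presheaf.stalk e) := ⟨q, hq⟩
    have h1 : Spec.map φ q' = IsLocalRing.closedPoint (X.presheaf.stalk e) := by
      apply PrimeSpectrum.ext
      exact (IsLocalRing.eq_maximalIdeal ((IsLocalRing.maximalIdeal.isMaximal _).eq_of_le
        (Spec.map φ q').isPrime.ne_top (Ideal.map_le_iff_le_comap.mp hmq) ▸ inferInstance))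
    have h2 := hfib (X.fromSpecStalk e q') ?_ ?_ ?_
    · have : q' = IsLocalRing.closedPoint (X.presheaf.stalk e) :=
        hemb.injective (h2.trans fromSpecStalk_closedPoint.symm)
      exact congr($(this).asIdeal)
    · rw [← hp]
      exact ((PrimeSpectrum.le_iff_specializes p q').mp hpq).map (X.fromSpecStalk e).continuous
    · exact (range_fromSpecStalk (X := X) (x := e)).le ⟨q', rfl⟩
    · rw [happ, h1, fromSpecStalk_closedPoint]

/-- Let `P` be a semigroup that is the space of closed points of a scheme `X`, and `e` an idempotent
with a neighbourhood `U` that contains no other idempotent. Suppose that left multiplication by `e`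
comes from an endomorphism `f` of `X`, that the image of `f` lies in a closed set `F` on which
`e * x = x`, and that `Y` is a closed set with closed points `{x | x * e = x}`. Then `exe = xe` for
every `x` in a closed irreducible set `Z` through `e`.

The set `Ze` is contained in a maximal irreducible subset `W` of `Pe`, and `W` is stable under `f`.
An element `y` of `Pe` with `ey = e` is idempotent, so that `e` is isolated in the fibre of `f` over
`e` in `W`, and `f` fixes the generic point of the closure of `W` by `apply_eq_of_isolated_fiber`. -/
theorem mul_right_eq_mul_mul_of_isolated {X : Scheme.{u}} [IsLocallyNoetherian X]
    [JacobsonSpace X] {P : Type*} [Semigroup P] [TopologicalSpace P] [SeparatelyContinuousMul P]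
    {t : P → X} (ht : Topology.IsEmbedding t) (htr : Set.range t = closedPoints X)
    {e : P} (he : IsIdempotentElem e) (f : X ⟶ X) (hft : ∀ x, f (t x) = t (e * x))
    {F Y : Set X} (hF : IsClosed F) (hfF : Set.range f ⊆ F) (hF' : ∀ x, t x ∈ F → e * x = x)
    (hY : IsClosed Y) (hY' : ∀ x, t x ∈ Y ↔ x * e = x)
    {U : Set X} (hU : IsOpen U) (heU : t e ∈ U)
    (hUe : ∀ x, IsIdempotentElem x → t x ∈ U → x = e)
    {Z : Set X} (hZ : IsClosed Z) (hZi : IsPreirreducible Z) (heZ : t e ∈ Z) {x : P}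
    (hx : t x ∈ Z) : e * (x * e) = x * e := by
  -- `M` is the subsemigroup `Pe`, with right identity `e`.
  let M : Subsemigroup P := ⟨{y | y * e = y}, fun {a b} _ hb ↦ by
    rw [Set.mem_ofPred_eq, mul_assoc, show b * e = b from hb]⟩
  have hsep : SeparatelyContinuousMul M :=
    ⟨fun {a} ↦ (SeparatelyContinuousMul.continuous_const_mul.comp continuous_subtype_val).subtype_mk
        _, fun {a} ↦
      (SeparatelyContinuousMul.continuous_mul_const.comp continuous_subtype_val).subtype_mk _⟩
  let r : P → M := fun y ↦ ⟨y * e, by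
    change y * e * e = y * e
    rw [mul_assoc, he]⟩
  have hr : Continuous r := SeparatelyContinuousMul.continuous_mul_const.subtype_mk _
  let eM : M := ⟨e, he⟩
  have hre : r e = eM := Subtype.ext he
  obtain ⟨W, hW, hAW, heW⟩ := ((hZi.preimage_of_range_eq_closedPoints ht.isInducing htr hZ).image r
    hr.continuousOn).exists_superset_mul_mem (e := eM) (fun y ↦ Subtype.ext y.2) ⟨e, heZ, hre⟩
  let s : M → X := fun y ↦ t y
  have hs : Continuous s := ht.continuous.comp continuous_subtype_val
  let T := closure (s '' W)
  have hT : IsIrreducible T :=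
    ⟨⟨s eM, subset_closure ⟨eM, hAW ⟨e, heZ, hre⟩, rfl⟩⟩, (hW.image s hs.continuousOn).closure⟩
  obtain ⟨w, hw⟩ := QuasiSober.sober hT isClosed_closure
  have hwT (y : X) : w ⤳ y ↔ y ∈ T := by
    rw [← hw.def, specializes_iff_mem_closure]
  have hfT : Set.MapsTo f T T := by
    refine Set.MapsTo.closure ?_ f.continuous
    rintro _ ⟨y, hy, rfl⟩
    exact ⟨_, heW y hy, (hft y).symm⟩
  have hfe : f (t e) = t e := by rw [hft, he]
  have hTY : T ⊆ Y := by
    refine closure_minimal ?_ hY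
    rintro _ ⟨y, hy, rfl⟩
    exact (hY' y).mpr y.2
  have hwe : w ⤳ t e := (hwT _).mpr (subset_closure ⟨eM, hAW ⟨e, heZ, hre⟩, rfl⟩)
  have hec : IsClosed {t e} := htr.le ⟨e, rfl⟩
  have key : f w = w := by
    refine apply_eq_of_isolated_fiber f hfe ((hwT _).mpr (hfT ((hwT _).mp specializes_rfl)))
      (by simpa [hfe] using hwe.map f.continuous) fun y hwy hye hfy ↦ ?_
    -- Otherwise some closed point `z ≠ e` in `U` is a specialization of `y`, hence idempotent.
    by_contra hne
    obtain ⟨z, ⟨hyz, hzU, hze⟩, hzc⟩ := nonempty_inter_closedPoints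
      (Z := closure {y} ∩ (U ∩ {t e}ᶜ)) ⟨y, subset_closure rfl, hye.mem_open hU heU, hne⟩
      (isClosed_closure.isLocallyClosed.inter (hU.inter hec.isOpen_compl).isLocallyClosed)
    obtain ⟨z, rfl⟩ := htr.ge hzc
    have hyz := specializes_iff_mem_closure.mpr hyz
    have hz1 : z * e = z := (hY' z).mp (hTY ((hwT _).mp (hwy.trans hyz)))
    have hz2 : t (e * z) = t e := by
      have := hyz.map f.continuous
      rw [hfy, hft, specializes_iff_mem_closure, hec.closure_eq] at this
      exact this
    have hz3 : e * z = e := ht.injective hz2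
    have hzz : z * z = z := by
      calc z * z = z * e * z := by rw [hz1]
        _ = z := by rw [mul_assoc, hz3, hz1]
    exact hze congr(t $(hUe z hzz hzU))
  apply hF'
  have hxT : t (x * e) ∈ T := subset_closure ⟨r x, hAW ⟨x, hx, rfl⟩, rfl⟩
  refine closure_minimal (Set.singleton_subset_iff.mpr (hfF ⟨w, key⟩)) hF ?_
  rwa [← specializes_iff_mem_closure, hwT]

end AlgebraicGeometry.Scheme

/-! ### Points of algebraic semigroups -/

namespace AlgebraicSemigroup

section Basic

variable {k : Type u} [Field k] (S : AlgebraicSemigroup k)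

attribute [instance] isReduced isSeparated locallyOfFiniteType quasiCompact

instance : IsLocallyNoetherian S.X.left := LocallyOfFiniteType.isLocallyNoetherian S.X.hom

instance : JacobsonSpace S.X.left := LocallyOfFiniteType.jacobsonSpace S.X.hom

instance : CompactSpace S.X.left := QuasiCompact.compactSpace_of_compactSpace S.X.hom

instance : IsNoetherian S.X.left where

/-- The product of two `T`-valued points of `S`. -/
def mulHom {T : Over (Spec (.of k))} (x y : T ⟶ S.X) : T ⟶ S.X := lift x y ≫ S.mul

theorem mulHom_assoc {T : Over (Spec (.of k))} (x y z : T ⟶ S.X) :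
    S.mulHom (S.mulHom x y) z = S.mulHom x (S.mulHom y z) := by
  simpa [mulHom] using congrArg (fun t ↦ lift (lift x y) z ≫ t) S.assoc

theorem comp_mulHom {T T' : Over (Spec (.of k))} (g : T' ⟶ T) (x y : T ⟶ S.X) :
    g ≫ S.mulHom x y = S.mulHom (g ≫ x) (g ≫ y) := by
  rw [mulHom, ← Category.assoc, comp_lift, mulHom]

variable {S}

/-- The constant `T`-valued point of `S` with value a `k`-rational point. -/
def Point.const (a : S.Point) (T : Over (Spec (.of k))) : T ⟶ S.X := toUnit T ≫ a.hom

theorem Point.comp_const (a : S.Point) {T T' : Over (Spec (.of k))} (g : T' ⟶ T) :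
    g ≫ a.const T = a.const T' := by
  simp [Point.const]

theorem Point.const_unit (a : S.Point) : a.const (𝟙_ _) = a.hom := by
  simp [Point.const, toUnit_unique (toUnit (𝟙_ (Over (Spec (.of k))))) (𝟙 _)]

theorem Point.mulHom_const (a b : S.Point) (T : Over (Spec (.of k))) :
    S.mulHom (a.const T) (b.const T) = (a * b).const T := by
  simp [mulHom, Point.const, comp_lift_assoc]

/-- Left multiplication by a `k`-rational point. -/
def mulLeft (a : S.Point) : S.X ⟶ S.X := S.mulHom (a.const _) (𝟙 _)

/-- Right multiplication by a `k`-rational point. -/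
def mulRight (a : S.Point) : S.X ⟶ S.X := S.mulHom (𝟙 _) (a.const _)

theorem comp_mulLeft (a : S.Point) {T : Over (Spec (.of k))} (x : T ⟶ S.X) :
    x ≫ mulLeft a = S.mulHom (a.const T) x := by
  simp [mulLeft, comp_mulHom, Point.comp_const]

theorem comp_mulRight (a : S.Point) {T : Over (Spec (.of k))} (x : T ⟶ S.X) :
    x ≫ mulRight a = S.mulHom x (a.const T) := by
  simp [mulRight, comp_mulHom, Point.comp_const]

theorem hom_comp_mulLeft (a x : S.Point) : x.hom ≫ mulLeft a = (a * x).hom := by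
  rw [comp_mulLeft, Point.const_unit]; rfl

theorem hom_comp_mulRight (a x : S.Point) : x.hom ≫ mulRight a = (x * a).hom := by
  rw [comp_mulRight, Point.const_unit]; rfl

theorem mulLeft_comp_self {e : S.Point} (he : IsIdempotentElem e) :
    mulLeft e ≫ mulLeft e = mulLeft e := by
  rw [comp_mulLeft, mulLeft, ← mulHom_assoc, Point.mulHom_const, he]

theorem mulRight_comp_self {e : S.Point} (he : IsIdempotentElem e) :
    mulRight e ≫ mulRight e = mulRight e := by
  rw [comp_mulRight, mulRight, mulHom_assoc, Point.mulHom_const, he]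

theorem toSpace_of_comp_eq {x y : S.Point} {f : S.X ⟶ S.X} (h : x.hom ≫ f = y.hom) :
    f.left x.toSpace = y.toSpace := by
  have := congrArg (fun g ↦ g.left (IsLocalRing.closedPoint k)) h
  exact this

/-- The Zariski topology on the set of `k`-rational points. -/
instance : TopologicalSpace S.Point := .induced Point.toSpace inferInstance

theorem isInducing_toSpace : Topology.IsInducing (Point.toSpace (S := S)) := ⟨rfl⟩

instance : SeparatelyContinuousMul S.Point where
  continuous_const_mul {a} := by
    rw [isInducing_toSpace.continuous_iff]
    have : Point.toSpace ∘ (a * ·) = (mulLeft a).left ∘ Point.toSpace := by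
      ext x
      exact (toSpace_of_comp_eq (hom_comp_mulLeft a x)).symm
    rw [this]
    exact (mulLeft a).left.continuous.comp isInducing_toSpace.continuous
  continuous_mul_const {a} := by
    rw [isInducing_toSpace.continuous_iff]
    have : Point.toSpace ∘ (· * a) = (mulRight a).left ∘ Point.toSpace := by
      ext x
      exact (toSpace_of_comp_eq (hom_comp_mulRight a x)).symm
    rw [this]
    exact (mulRight a).left.continuous.comp isInducing_toSpace.continuous

theorem Point.left_comp (x : S.Point) : x.left ≫ S.X.hom = 𝟙 _ := Over.w x.hom

instance : IsClosedImmersion S.ιE := by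
  have : IsClosedImmersion (lift (𝟙 S.X) (𝟙 S.X)).left :=
    inferInstanceAs (IsClosedImmersion (Limits.pullback.diagonal S.X.hom))
  have hst : MorphismProperty.IsStableUnderBaseChange @IsClosedImmersion.{u} := inferInstance
  exact hst.of_isPullback (IsPullback.of_hasPullback _ _).flip this

end Basic

section AlgClosed

variable {k : Type u} [Field k] [IsAlgClosed k] {S : AlgebraicSemigroup k}

theorem toSpace_injective : Function.Injective (Point.toSpace (S := S)) := by
  intro x y h
  have : x.left = y.left := ext_of_apply_closedPoint_eq S.X.hom x.left_comp y.left_comp h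
  ext1
  exact Over.OverMorphism.ext this

theorem isEmbedding_toSpace : Topology.IsEmbedding (Point.toSpace (S := S)) :=
  ⟨isInducing_toSpace, toSpace_injective⟩

theorem range_toSpace : Set.range (Point.toSpace (S := S)) = closedPoints S.X.left := by
  apply subset_antisymm
  · rintro _ ⟨x, rfl⟩
    exact (pointEquivClosedPoint S.X.hom ⟨x.left, x.left_comp⟩).2
  · intro y hy
    exact ⟨⟨Over.homMk (pointOfClosedPoint S.X.hom y hy) (pointOfClosedPoint_comp _ _ _)⟩,
      pointOfClosedPoint_apply _ _ _ _⟩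

/-- The locus where an endomorphism of `S` is the identity, as the image of the equalizer; it
contains the image of the endomorphism if the latter is idempotent. -/
theorem exists_isClosed_fixed (f : S.X ⟶ S.X) :
    ∃ F : Set S.X.left, IsClosed F ∧ (∀ x : S.Point, x.toSpace ∈ F ↔ x.hom ≫ f = x.hom) ∧
      (f ≫ f = f → Set.range f.left ⊆ F) := by
  refine ⟨Set.range (Limits.equalizer.ι f (𝟙 _)).left,
    (Limits.equalizer.ι f (𝟙 _)).left.isClosedEmbedding.isClosed_range, fun x ↦ ⟨?_, fun h ↦ ?_⟩,
    fun h ↦ ?_⟩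
  · rintro ⟨p, hp⟩
    have h1 := congr($(Limits.equalizer.condition f (𝟙 _)).left p)
    let y : S.Point := ⟨x.hom ≫ f⟩
    have : y = x := by
      apply toSpace_injective
      rw [← toSpace_of_comp_eq (x := x) (f := f) rfl, ← hp]
      simpa using h1
    exact congr($(this).hom)
  · have := congr($(Limits.equalizer.lift_ι (f := f) (g := 𝟙 _) x.hom (by simpa using h)).left
      (IsLocalRing.closedPoint k))
    exact ⟨_, this⟩
  · rintro _ ⟨p, rfl⟩
    have := congr($(Limits.equalizer.lift_ι (f := f) (g := 𝟙 _) f (by simpa using h)).left p)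
    exact ⟨_, this⟩

theorem exists_isOpen_of_isIsolated {e : S.Point} {he : IsIdempotentElem e}
    (h : IsIsolated e he) : ∃ U : Set S.X.left, IsOpen U ∧ e.toSpace ∈ U ∧
      ∀ x : S.Point, IsIdempotentElem x → x.toSpace ∈ U → x = e := by
  obtain ⟨U, hU, hUe⟩ := S.ιE.isEmbedding.isInducing.isOpen_iff.mp h
  refine ⟨U, hU, ?_, fun x hx hxU ↦ ?_⟩
  · rw [← ιE_toE e he]
    exact hUe.ge rfl
  · have : toE x hx = toE e he := hUe.le (by rwa [Set.mem_preimage, ιE_toE])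
    apply toSpace_injective
    rw [← ιE_toE x hx, this, ιE_toE]

/-- An isolated idempotent `e` satisfies `xe = exe` for all `x ∈ C(e)`, and `ex = exe` by the same
argument in the opposite semigroup. -/
theorem mem_centralizer_of_isIsolated {e : S.Point} {he : IsIdempotentElem e}
    (h : IsIsolated e he) : e ∈ Set.centralizer (C e) := by
  obtain ⟨U, hU, heU, hUe⟩ := exists_isOpen_of_isIsolated h
  obtain ⟨F, hF, hF', hfF⟩ := exists_isClosed_fixed (mulLeft e)
  obtain ⟨Y, hY, hY', hfY⟩ := exists_isClosed_fixed (mulRight e)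
  have hF' (x : S.Point) : x.toSpace ∈ F ↔ e * x = x := by
    rw [hF', hom_comp_mulLeft, Point.ext_iff]
  have hY' (x : S.Point) : x.toSpace ∈ Y ↔ x * e = x := by
    rw [hY', hom_comp_mulRight, Point.ext_iff]
  rintro x ⟨Z, hZ, heZ, hxZ⟩
  have h1 : e * (x * e) = x * e := Scheme.mul_right_eq_mul_mul_of_isolated isEmbedding_toSpace
    range_toSpace he (mulLeft e).left
    (fun x ↦ toSpace_of_comp_eq (hom_comp_mulLeft e x)) hF (hfF (mulLeft_comp_self he))
    (fun x ↦ (hF' x).mp) hY hY' hU heU hUe (isClosed_of_mem_irreducibleComponents Z hZ) hZ.1.2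
    heZ hxZ
  have h2 : MulOpposite.op e * (.op x * .op e) = .op x * .op e :=
    Scheme.mul_right_eq_mul_mul_of_isolated (P := S.Pointᵐᵒᵖ) (t := Point.toSpace ∘ MulOpposite.unop)
    (isEmbedding_toSpace.comp MulOpposite.opHomeomorph.symm.isEmbedding)
    (by rw [MulOpposite.unop_surjective.range_comp, range_toSpace])
    (congrArg MulOpposite.op he) (mulRight e).left
    (fun x ↦ toSpace_of_comp_eq (hom_comp_mulRight e x.unop)) hY (hfY (mulRight_comp_self he))
    (fun x hx ↦ congrArg MulOpposite.op ((hY' x.unop).mp hx)) hF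
    (fun x ↦ (hF' x.unop).trans MulOpposite.op_injective.eq_iff.symm) hU heU
    (fun x hx hxU ↦ congrArg MulOpposite.op (hUe x.unop (congrArg MulOpposite.unop hx) hxU))
    (isClosed_of_mem_irreducibleComponents Z hZ) hZ.1.2 heZ hxZ
  have h2 : e * x * e = e * x := MulOpposite.op_injective h2
  rw [← h1, ← mul_assoc, h2]

end AlgClosed

end AlgebraicSemigroup

/-! ### The fibre square of a square-zero extension -/

/-- The fibre product of two copies of `ε : B →+* K`, as a subring of `B × B`. -/
abbrev fiberSquare {B K : Type*} [CommRing B] [CommRing K] (ε : B →+* K) : Subring (B × B) :=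
  (ε.comp (RingHom.fst B B)).eqLocus (ε.comp (RingHom.snd B B))

namespace fiberSquare

variable {B K : Type*} [CommRing B] [CommRing K] (ε : B →+* K)

/-- The first projection. -/
def fst : fiberSquare ε →+* B := (RingHom.fst B B).comp (fiberSquare ε).subtype

/-- The second projection. -/
def snd : fiberSquare ε →+* B := (RingHom.snd B B).comp (fiberSquare ε).subtype

variable {ε} {κ : K →+* B} (hκ : ε.comp κ = RingHom.id K)

/-- The map `b ↦ (b, ε b)`, for a section `κ : K →+* B` of `ε` by which `ε b` is read in `B`. -/
def inl : B →+* fiberSquare ε :=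
  ((RingHom.id B).prod (κ.comp ε)).codRestrict _ fun b ↦ (congr($hκ (ε b))).symm

/-- The map `b ↦ (ε b, b)`, where `ε b` is read in `B` by means of the section `κ`. -/
def inr : B →+* fiberSquare ε :=
  ((κ.comp ε).prod (RingHom.id B)).codRestrict _ fun b ↦ congr($hκ (ε b))

/-- The codiagonal `(b, c) ↦ b + c - ε b` of `B = K ⊕ I`, that is, `(a + v, a + w) ↦ a + v + w`. It is
multiplicative because the kernel `I` of `ε` has square zero. -/
def codiag (hε : ∀ a b, ε a = 0 → ε b = 0 → a * b = 0) : fiberSquare ε →+* B where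
  toFun z := fst ε z + snd ε z - κ (ε (fst ε z))
  map_one' := by simp
  map_zero' := by simp
  map_add' x y := by simp only [map_add]; ring
  map_mul' x y := by
    have hεκ (a : K) : ε (κ a) = a := congr($hκ a)
    have hx : ε (fst ε x) = ε (snd ε x) := x.2
    have hy : ε (fst ε y) = ε (snd ε y) := y.2
    have h1 := hε (fst ε x - κ (ε (fst ε x))) (snd ε y - κ (ε (fst ε y)))
      (by simp [hεκ]) (by simp [hεκ, hy])
    have h2 := hε (snd ε x - κ (ε (fst ε x))) (fst ε y - κ (ε (fst ε y)))
      (by simp [hεκ, hx]) (by simp [hεκ])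
    simp only [map_mul]
    linear_combination -h1 - h2

theorem isLocalRing [IsLocalRing B] (hκ : ε.comp κ = RingHom.id K)
    (hε : ∀ a b, ε a = 0 → ε b = 0 → a * b = 0) :
    IsLocalRing (fiberSquare ε) := by
  have : IsLocalHom (fst ε) := by
    refine ⟨fun z hz ↦ ?_⟩
    have hεκ (a : K) : ε (κ a) = a := congr($hκ a)
    obtain ⟨c, hc⟩ := hz.exists_right_inv
    have hz : ε (fst ε z) = ε (snd ε z) := z.2
    have hu : ε (snd ε z * κ (ε c)) = 1 := by
      rw [map_mul, hεκ, ← hz, ← map_mul, hc, map_one]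
    have hn := hε (snd ε z * κ (ε c) - 1) (snd ε z * κ (ε c) - 1) (by rw [map_sub, hu]; simp)
      (by rw [map_sub, hu]; simp)
    refine IsUnit.of_mul_eq_one ⟨(c, κ (ε c) * (2 - snd ε z * κ (ε c))), ?_⟩ ?_
    · change ε c = ε (κ (ε c) * (2 - snd ε z * κ (ε c)))
      rw [map_mul, map_sub, hu, hεκ, map_ofNat]
      ring
    · apply Subtype.ext
      refine Prod.ext hc ?_
      change snd ε z * (κ (ε c) * (2 - snd ε z * κ (ε c))) = 1
      linear_combination -hn
  exact RingHom.domain_isLocalRing (fst ε)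

/-- The fibre square with its structure maps, in the category of rings. -/
theorem exists_commRingCat {k : Type u} [Field k] {B : CommRingCat.{u}} [IsLocalRing B]
    {κ : CommRingCat.of k ⟶ B} {ε : B ⟶ CommRingCat.of k} (hκ : κ ≫ ε = 𝟙 _)
    (hε : ∀ a b : B, ε a = 0 → ε b = 0 → a * b = 0) :
    ∃ (B' : CommRingCat.{u}) (_ : IsLocalRing B') (p₁ p₂ δ : B' ⟶ B) (i₁ i₂ : B ⟶ B'),
      i₁ ≫ p₁ = 𝟙 _ ∧ i₁ ≫ p₂ = ε ≫ κ ∧ i₂ ≫ p₁ = ε ≫ κ ∧ i₂ ≫ p₂ = 𝟙 _ ∧ i₁ ≫ δ = 𝟙 _ ∧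
      i₂ ≫ δ = 𝟙 _ ∧ κ ≫ i₂ = κ ≫ i₁ ∧ ∀ z : B', δ z = p₁ z + p₂ z - (p₁ ≫ ε ≫ κ) z := by
  have hκ' : ε.hom.comp κ.hom = RingHom.id k := congr($(hκ).hom)
  have hεκ (a : k) : ε.hom (κ.hom a) = a := congr($hκ' a)
  refine ⟨.of (fiberSquare ε.hom), isLocalRing hκ' hε, CommRingCat.ofHom (fst ε.hom),
    CommRingCat.ofHom (snd ε.hom), CommRingCat.ofHom (codiag hκ' hε),
    CommRingCat.ofHom (inl hκ'), CommRingCat.ofHom (inr hκ'), rfl, rfl, rfl, rfl, ?_, ?_, ?_,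
    fun z ↦ rfl⟩
  · ext b
    exact add_sub_cancel_right b _
  · ext b
    change κ.hom (ε.hom b) + b - κ.hom (ε.hom (κ.hom (ε.hom b))) = b
    rw [hεκ, add_sub_cancel_left]
  · apply CommRingCat.hom_ext
    refine RingHom.ext fun a ↦ Subtype.ext (Prod.ext ?_ ?_)
    · exact congrArg κ.hom (hεκ a)
    · exact (congrArg κ.hom (hεκ a)).symm

end fiberSquare

/-! ### Tangent vectors at an idempotent -/

namespace AlgebraicSemigroup

section Thickening

variable {k : Type u} [Field k] {S : AlgebraicSemigroup k} {B : CommRingCat.{u}}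
  {κ : CommRingCat.of k ⟶ B} {ε : B ⟶ CommRingCat.of k} (hκ : κ ≫ ε = 𝟙 _)

/-- For an augmented `k`-algebra `B`, with structure map `κ` and augmentation `ε`, the `k`-rational
point of `Spec B` given by `ε`. -/
def augmentation : 𝟙_ (Over (Spec (.of k))) ⟶ Over.mk (Spec.map κ) :=
  Over.homMk (Spec.map ε) (by
    change Spec.map ε ≫ Spec.map κ = 𝟙 _
    rw [← Spec.map_comp, hκ, Spec.map_id])

/-- A `B`-valued point of `S` that reduces to `e` is given by a ring homomorphism from the local ring of
`S` at `e` to `B`. -/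
theorem exists_SpecMap_fromSpecStalk [IsLocalRing B] {e : S.Point}
    {x : Over.mk (Spec.map κ) ⟶ S.X} (hx : augmentation hκ ≫ x = e.hom) :
    ∃ φ : S.X.left.presheaf.stalk e.toSpace ⟶ B,
      Spec.map φ ≫ S.X.left.fromSpecStalk e.toSpace = x.left := by
  have hε : IsLocalHom ε.hom := .of_surjective _ fun a ↦ ⟨κ.hom a, congr($(hκ).hom a)⟩
  have h1 : x.left (IsLocalRing.closedPoint B) = e.toSpace := by
    have h2 := congr($(hx).left (IsLocalRing.closedPoint k))
    refine Eq.trans ?_ h2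
    exact congrArg x.left (Spec_closedPoint (f := ε)).symm
  obtain ⟨φ, -, hφ⟩ := Scheme.exists_isLocalHom_SpecMap_fromSpecStalk x.left h1
  exact ⟨φ, hφ⟩

theorem exists_left_eq_SpecMap {A A' : CommRingCat.{u}} {a : .of k ⟶ A} {a' : .of k ⟶ A'}
    (g : A ⟶ A') (h : a ≫ g = a') :
    ∃ G : Over.mk (Spec.map a') ⟶ Over.mk (Spec.map a), G.left = Spec.map g :=
  ⟨Over.homMk (Spec.map g) (by
    change Spec.map g ≫ Spec.map a = Spec.map a'
    rw [← Spec.map_comp, h]), rfl⟩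

theorem SpecMap_fromSpecStalk_injective (X : Scheme.{u}) (x : X)
    {φ ψ : X.presheaf.stalk x ⟶ B}
    (h : Spec.map φ ≫ X.fromSpecStalk x = Spec.map ψ ≫ X.fromSpecStalk x) : φ = ψ :=
  Spec.map_injective ((cancel_mono _).mp h)

/-- The differential of the multiplication at `(e, e)` is `(v, w) ↦ v e + e w`, in terms of functions: if
`x` is a tangent vector at `e`, that is, a point with values in a square-zero extension `B` of `k`
that reduces to `e`, then `f(x²) + f(e) = f(xe) + f(ex)` for all functions `f` at `e`.

The product `z` of the two pullbacks of `x` to `B ×ₖ B` restricts to `xe` and `ex` along the two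
projections, and to `x²` along the codiagonal. -/
theorem stalk_mul_self [IsLocalRing B] (hε : ∀ a b : B, ε a = 0 → ε b = 0 → a * b = 0)
    {e : S.Point} (he : IsIdempotentElem e)
    {x : Over.mk (Spec.map κ) ⟶ S.X} (hx : augmentation hκ ≫ x = e.hom)
    {φ φl φr φe : S.X.left.presheaf.stalk e.toSpace ⟶ B}
    (hφ : Spec.map φ ≫ S.X.left.fromSpecStalk e.toSpace = (S.mulHom x x).left)
    (hφl : Spec.map φl ≫ S.X.left.fromSpecStalk e.toSpace = (S.mulHom x (e.const _)).left)
    (hφr : Spec.map φr ≫ S.X.left.fromSpecStalk e.toSpace = (S.mulHom (e.const _) x).left)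
    (hφe : Spec.map φe ≫ S.X.left.fromSpecStalk e.toSpace =
      (e.const (Over.mk (Spec.map κ))).left) (f) :
    φ f + φe f = φl f + φr f := by
  obtain ⟨B', hloc, p₁, p₂, δ, i₁, i₂, hi₁p₁, hi₁p₂, hi₂p₁, hi₂p₂, hi₁δ, hi₂δ, hκi, hδ⟩ :=
    fiberSquare.exists_commRingCat hκ hε
  let T := Over.mk (Spec.map κ)
  let T' := Over.mk (Spec.map (κ ≫ i₁))
  obtain ⟨I₁, hI₁⟩ := exists_left_eq_SpecMap (a := κ) i₁ rfl
  obtain ⟨I₂, hI₂⟩ := exists_left_eq_SpecMap (a := κ) i₂ hκi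
  obtain ⟨P₁, hP₁⟩ := exists_left_eq_SpecMap (a := κ ≫ i₁) (a' := κ) p₁
    (by rw [Category.assoc, hi₁p₁, Category.comp_id])
  obtain ⟨P₂, hP₂⟩ := exists_left_eq_SpecMap (a := κ ≫ i₁) (a' := κ) p₂
    (by rw [Category.assoc, hi₁p₂, reassoc_of% hκ])
  obtain ⟨D, hD⟩ := exists_left_eq_SpecMap (a := κ ≫ i₁) (a' := κ) δ
    (by rw [Category.assoc, hi₁δ, Category.comp_id])
  have hid (h : T ⟶ T) (hh : h.left = Spec.map (𝟙 B)) : h ≫ x = x := by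
    have : h = 𝟙 T := Over.OverMorphism.ext (hh.trans (Spec.map_id B))
    rw [this, Category.id_comp]
  have hconst (h : T ⟶ T) (hh : h.left = Spec.map (ε ≫ κ)) : h ≫ x = e.const T := by
    have : h = toUnit T ≫ augmentation hκ :=
      Over.OverMorphism.ext (hh.trans (Spec.map_comp ε κ))
    rw [this, Category.assoc, hx, Point.const]
  let z : T' ⟶ S.X := S.mulHom (I₁ ≫ x) (I₂ ≫ x)
  have hP₁z : P₁ ≫ z = S.mulHom x (e.const _) := by
    rw [comp_mulHom, ← Category.assoc, ← Category.assoc, hid (P₁ ≫ I₁), hconst (P₁ ≫ I₂)]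
    · rw [Over.comp_left, hP₁, hI₂, ← Spec.map_comp, hi₂p₁]
    · rw [Over.comp_left, hP₁, hI₁, ← Spec.map_comp, hi₁p₁]
  have hP₂z : P₂ ≫ z = S.mulHom (e.const _) x := by
    rw [comp_mulHom, ← Category.assoc, ← Category.assoc, hconst (P₂ ≫ I₁), hid (P₂ ≫ I₂)]
    · rw [Over.comp_left, hP₂, hI₂, ← Spec.map_comp, hi₂p₂]
    · rw [Over.comp_left, hP₂, hI₁, ← Spec.map_comp, hi₁p₂]
  have hDz : D ≫ z = S.mulHom x x := by
    rw [comp_mulHom, ← Category.assoc, ← Category.assoc, hid (D ≫ I₁), hid (D ≫ I₂)]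
    · rw [Over.comp_left, hD, hI₂, ← Spec.map_comp, hi₂δ]
    · rw [Over.comp_left, hD, hI₁, ← Spec.map_comp, hi₁δ]
  have hκ₁ : (κ ≫ i₁) ≫ (p₁ ≫ ε) = 𝟙 _ := by
    rw [Category.assoc, reassoc_of% hi₁p₁, hκ]
  have hz : augmentation hκ₁ ≫ z = e.hom := by
    have : augmentation hκ₁ = augmentation hκ ≫ P₁ := by
      apply Over.OverMorphism.ext
      rw [Over.comp_left, hP₁]
      exact Spec.map_comp _ _
    rw [this, Category.assoc, hP₁z, comp_mulHom, hx, Point.comp_const, Point.const_unit]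
    exact congrArg Point.hom he
  obtain ⟨φz, hφz⟩ := exists_SpecMap_fromSpecStalk hκ₁ hz
  have h₁ : φz ≫ p₁ = φl := by
    apply SpecMap_fromSpecStalk_injective
    rw [Spec.map_comp, Category.assoc, hφz, hφl, ← hP₁z, Over.comp_left, hP₁]
  have h₂ : φz ≫ p₂ = φr := by
    apply SpecMap_fromSpecStalk_injective
    rw [Spec.map_comp, Category.assoc, hφz, hφr, ← hP₂z, Over.comp_left, hP₂]
  have h₃ : φz ≫ δ = φ := by
    apply SpecMap_fromSpecStalk_injective
    rw [Spec.map_comp, Category.assoc, hφz, hφ, ← hDz, Over.comp_left, hD]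
  have h₄ : φl ≫ ε ≫ κ = φe := by
    apply SpecMap_fromSpecStalk_injective
    rw [Spec.map_comp, Category.assoc, hφl, hφe, Spec.map_comp, Category.assoc]
    have : (toUnit T ≫ augmentation hκ) ≫ S.mulHom x (e.const _) = e.const _ := by
      rw [Category.assoc, comp_mulHom, hx, Point.comp_const, Point.const_unit]
      exact congrArg (fun t ↦ toUnit T ≫ t) (congrArg Point.hom he)
    exact congr($(this).left)
  rw [← h₄, ← h₁, ← h₂, ← h₃]
  have := hδ (φz f)
  simp only [CommRingCat.comp_apply] at this ⊢
  rw [this, sub_add_cancel]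

/-- An idempotent tangent vector `x` at `e` that commutes with `e` is zero: by `stalk_mul_self`,
`f(y) = 2 f(ey) - f(e)` for `y = x` and for `y = ex`. The second case gives `ex = e`, and then the
first gives `x = e`. -/
theorem eq_const_of_idempotent [IsLocalRing B] (hε : ∀ a b : B, ε a = 0 → ε b = 0 → a * b = 0)
    {e : S.Point} (he : IsIdempotentElem e)
    {x : Over.mk (Spec.map κ) ⟶ S.X} (hx : augmentation hκ ≫ x = e.hom)
    (hxx : S.mulHom x x = x) (hex : S.mulHom (e.const _) x = S.mulHom x (e.const _)) :
    x = e.const _ := by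
  have hee (T) : S.mulHom (e.const T) (e.const T) = e.const T := by rw [Point.mulHom_const, he]
  have haug : augmentation hκ ≫ e.const _ = e.hom := by
    rw [Point.comp_const, Point.const_unit]
  have haugee : S.mulHom e.hom e.hom = e.hom := congrArg Point.hom he
  obtain ⟨φe, hφe⟩ := exists_SpecMap_fromSpecStalk hκ haug
  -- The alternatives of the last hypothesis give `f(y) + f(e) = 2 f(y)` and `f(y) + f(e) = 2 f(e)`.
  have key : ∀ y : Over.mk (Spec.map κ) ⟶ S.X, augmentation hκ ≫ y = e.hom →
      S.mulHom y y = y → S.mulHom (e.const _) y = S.mulHom y (e.const _) →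
      (S.mulHom (e.const _) y = y ∨ S.mulHom (e.const _) y = e.const _) → y = e.const _ := by
    intro y hy hyy hey h
    obtain ⟨φ, hφ⟩ := exists_SpecMap_fromSpecStalk hκ hy
    suffices φ = φe by
      apply Over.OverMorphism.ext
      rw [← hφ, this, hφe]
    ext f
    rcases h with h | h
    · have := stalk_mul_self hκ hε he hy (φ := φ) (φl := φ) (φr := φ) (φe := φe)
        (by rw [hφ, hyy]) (by rw [hφ, ← hey, h]) (by rw [hφ, h]) hφe f
      exact (add_left_cancel this).symm
    · have := stalk_mul_self hκ hε he hy (φ := φ) (φl := φe) (φr := φe) (φe := φe)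
        (by rw [hφ, hyy]) (by rw [hφe, ← hey, h]) (by rw [hφe, h]) hφe f
      exact add_right_cancel this
  refine key x hx hxx hex (.inr (key _ ?_ ?_ ?_ (.inl ?_)))
  · rw [comp_mulHom, hx, Point.comp_const, Point.const_unit, haugee]
  · rw [mulHom_assoc, ← S.mulHom_assoc x, ← hex, mulHom_assoc, hxx, ← mulHom_assoc, hee]
  · rw [hex, mulHom_assoc, ← S.mulHom_assoc, hex, hee, mulHom_assoc, hee]
  · rw [← mulHom_assoc, hee]

end Thickening

end AlgebraicSemigroup

/-! ### The local ring of the scheme of idempotents -/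

namespace AlgebraicSemigroup

variable {k : Type u} [Field k] {S : AlgebraicSemigroup k}

/-- On `E(S)` the square map of `S` is the inclusion. -/
theorem ιE_sq : S.ιE ≫ S.sq.left = S.ιE := by
  have h : S.ιE ≫ (lift S.sq (𝟙 S.X)).left =
    Limits.pullback.snd _ _ ≫ (lift (𝟙 S.X) (𝟙 S.X)).left := Limits.pullback.condition
  have h1 := congr($h ≫ (CartesianMonoidalCategory.fst S.X S.X).left)
  have h2 := congr($h ≫ (CartesianMonoidalCategory.snd S.X S.X).left)
  simp only [Category.assoc, ← Over.comp_left, lift_fst, lift_snd, Over.id_left,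
    Category.comp_id] at h1 h2
  exact h1.trans h2.symm

theorem idempotentPoint_ιE (e : S.Point) (he : IsIdempotentElem e) :
    idempotentPoint e he ≫ S.ιE = e.left := Limits.pullback.lift_fst _ _ _

/-- A `T`-valued point of `S` that factors through `E(S)` is idempotent. -/
theorem mulHom_self_of_left_eq {T : Over (Spec (.of k))} (x : T ⟶ S.X) (g : T.left ⟶ S.E)
    (hg : g ≫ S.ιE = x.left) : S.mulHom x x = x := by
  have : S.mulHom x x = x ≫ S.sq := by
    rw [sq, ← Category.assoc, comp_lift, Category.comp_id, mulHom]
  rw [this]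
  apply Over.OverMorphism.ext
  rw [Over.comp_left, ← hg, Category.assoc, ιE_sq]

instance : IsNoetherian S.E where
  toIsLocallyNoetherian := LocallyOfFiniteType.isLocallyNoetherian S.ιE
  toCompactSpace := S.ιE.isClosedEmbedding.compactSpace

/-- If `e` centralizes `C(e)`, then `ex = xe` holds as an identity of morphisms on a neighbourhood of
`e`, because `S` is reduced and separated and `k` is algebraically closed. -/
theorem exists_open_comp_mulLeft_eq [IsAlgClosed k] {e : S.Point}
    (he : e ∈ Set.centralizer (C e)) : ∃ U : S.X.left.Opens, e.toSpace ∈ U ∧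
      (Over.homMk U.ι : Over.mk (U.ι ≫ S.X.hom) ⟶ S.X) ≫ mulLeft e =
        (Over.homMk U.ι : Over.mk (U.ι ≫ S.X.hom) ⟶ S.X) ≫ mulRight e := by
  obtain ⟨U, hU, heU, hUC⟩ := exists_isOpen_forall_mem_irreducibleComponents e.toSpace
  let V : S.X.left.Opens := ⟨U, hU⟩
  have hl : (V.ι ≫ (mulLeft e).left) ≫ S.X.hom = V.ι ≫ S.X.hom := by
    rw [Category.assoc, Over.w]
  refine ⟨V, heU, Over.OverMorphism.ext ?_⟩
  have : LocallyOfFiniteType ((V.ι ≫ (mulLeft e).left) ≫ S.X.hom) := hl ▸ inferInstance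
  refine ext_of_apply_eq (f := V.ι ≫ (mulLeft e).left) (g := V.ι ≫ (mulRight e).left) S.X.hom
    Set.univ isClosed_univ.isLocallyClosed dense_univ (fun y _ hy ↦ ?_) ?_
  · have hy' : V.ι y ∈ closedPoints S.X.left :=
      V.ι.isOpenEmbedding.preimage_closedPoints.ge hy
    obtain ⟨x, hx⟩ := range_toSpace.ge hy'
    have hxC : x ∈ C e := by
      refine ⟨irreducibleComponent x.toSpace, irreducibleComponent_mem_irreducibleComponents _,
        hUC x.toSpace ?_ _ (irreducibleComponent_mem_irreducibleComponents _)
        mem_irreducibleComponent, mem_irreducibleComponent⟩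
      rw [hx]
      exact y.2
    rw [Scheme.Hom.comp_apply, Scheme.Hom.comp_apply, ← hx,
      toSpace_of_comp_eq (hom_comp_mulLeft e x), toSpace_of_comp_eq (hom_comp_mulRight e x), he x hxC]
  · rw [hl, Category.assoc, Over.w]

/-- If `e` centralizes `C(e)`, then the local ring `O` of `E(S)` at `e` is a field. The tautological
point of `E(S)` with values in `O ⧸ m ^ 2` is an idempotent tangent vector at `e` that commutes with
`e`, hence is constant; so `m = m ^ 2`, and `m = 0` by Nakayama's lemma. -/
theorem maximalIdeal_stalk_E_eq_bot [IsAlgClosed k] {e : S.Point} (he : IsIdempotentElem e)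
    (hC : e ∈ Set.centralizer (C e)) :
    IsLocalRing.maximalIdeal (S.E.presheaf.stalk (toE e he)) = ⊥ := by
  let O := S.E.presheaf.stalk (toE e he)
  let m := IsLocalRing.maximalIdeal O
  -- The structure map `κ₀` and the evaluation `ε₀` at `e` of the `k`-algebra `O`.
  let κ₀ : CommRingCat.of k ⟶ O :=
    Spec.preimage (S.E.fromSpecStalk (toE e he) ≫ S.ιE ≫ S.X.hom)
  have hκ₀ : Spec.map κ₀ = S.E.fromSpecStalk (toE e he) ≫ S.ιE ≫ S.X.hom := Spec.map_preimage _
  obtain ⟨ε₀, hε₀l, hε₀⟩ := Scheme.exists_isLocalHom_SpecMap_fromSpecStalk (idempotentPoint e he)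
    (x := toE e he) rfl
  have hκε₀ : κ₀ ≫ ε₀ = 𝟙 _ := by
    apply Spec.map_injective
    rw [Spec.map_comp, hκ₀, reassoc_of% hε₀, reassoc_of% (idempotentPoint_ιE e he),
      Point.left_comp, Spec.map_id]
  have hε₀m (f : O) (hf : f ∈ m) : ε₀ f = 0 := by
    by_contra h
    exact (IsLocalRing.mem_maximalIdeal _).mp hf (hε₀l.map_nonunit f (Ne.isUnit h))
  let B : CommRingCat.{u} := .of (O ⧸ m ^ 2)
  let π : O ⟶ B := CommRingCat.ofHom (Ideal.Quotient.mk (m ^ 2))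
  let ε : B ⟶ .of k := CommRingCat.ofHom (Ideal.Quotient.lift (m ^ 2) ε₀.hom fun f hf ↦
    hε₀m f (Ideal.pow_le_self two_ne_zero hf))
  have hπε : π ≫ ε = ε₀ := by
    ext f
    rfl
  let κ : .of k ⟶ B := κ₀ ≫ π
  have hκ : κ ≫ ε = 𝟙 _ := by rw [Category.assoc, hπε, hκε₀]
  have hm : m ^ 2 ≠ ⊤ := fun h ↦ (IsLocalRing.maximalIdeal.isMaximal O).ne_top
    (top_le_iff.mp (h ▸ Ideal.pow_le_self two_ne_zero))
  have : Nontrivial B := Ideal.Quotient.nontrivial_iff (R := O) (I := m ^ 2) |>.mpr hm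
  have : IsLocalRing B := .of_surjective' _ (Ideal.Quotient.mk_surjective (I := m ^ 2))
  have hπl : IsLocalHom π.hom := .of_surjective _ (Ideal.Quotient.mk_surjective (R := O) (I := m ^ 2))
  have hε : ∀ a b : B, ε a = 0 → ε b = 0 → a * b = 0 := by
    intro a b ha hb
    obtain ⟨a, rfl⟩ := Ideal.Quotient.mk_surjective (R := O) (I := m ^ 2) a
    obtain ⟨b, rfl⟩ := Ideal.Quotient.mk_surjective (R := O) (I := m ^ 2) b
    have hker (c : O) (hc : ε₀ c = 0) : c ∈ m := by
      refine (IsLocalRing.mem_maximalIdeal _).mpr fun h ↦ ?_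
      exact (h.map ε₀.hom).ne_zero hc
    rw [← map_mul, Ideal.Quotient.eq_zero_iff_mem, pow_two]
    exact Ideal.mul_mem_mul (hker a ha) (hker b hb)
  let g : Spec B ⟶ S.E := Spec.map π ≫ S.E.fromSpecStalk (toE e he)
  have hg : g (IsLocalRing.closedPoint B) = toE e he :=
    (congrArg (S.E.fromSpecStalk (toE e he)) (Spec_closedPoint (f := π))).trans
      Scheme.fromSpecStalk_closedPoint
  let x : Over.mk (Spec.map κ) ⟶ S.X := Over.homMk (g ≫ S.ιE) (by
    change (g ≫ S.ιE) ≫ S.X.hom = Spec.map κ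
    rw [Category.assoc, Category.assoc, ← hκ₀, ← Spec.map_comp])
  have hx : augmentation hκ ≫ x = e.hom := by
    apply Over.OverMorphism.ext
    change Spec.map ε ≫ (Spec.map π ≫ S.E.fromSpecStalk (toE e he)) ≫ S.ιE = e.left
    rw [← Category.assoc, ← Category.assoc, ← Spec.map_comp, hπε, hε₀, idempotentPoint_ιE]
  have hex : S.mulHom (e.const _) x = S.mulHom x (e.const _) := by
    obtain ⟨U, heU, hU⟩ := exists_open_comp_mulLeft_eq hC
    have hxe : x.left (IsLocalRing.closedPoint B) = e.toSpace :=
      (congrArg S.ιE hg).trans (ιE_toE e he)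
    have hrange : Set.range x.left ⊆ Set.range U.ι := by
      rintro _ ⟨b, rfl⟩
      rw [Scheme.Opens.range_ι]
      have hspec : x.left b ⤳ e.toSpace :=
        hxe ▸ (IsLocalRing.specializes_closedPoint b).map x.left.continuous
      exact hspec.mem_open U.2 heU
    let y : Over.mk (Spec.map κ) ⟶ Over.mk (U.ι ≫ S.X.hom) :=
      Over.homMk (IsOpenImmersion.lift U.ι x.left hrange) (by
        change IsOpenImmersion.lift U.ι x.left hrange ≫ U.ι ≫ S.X.hom = Spec.map κ
        rw [IsOpenImmersion.lift_fac_assoc]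
        exact Over.w x)
    have hy : y ≫ Over.homMk U.ι = x :=
      Over.OverMorphism.ext (IsOpenImmersion.lift_fac U.ι x.left hrange)
    rw [← comp_mulLeft, ← comp_mulRight, ← hy, Category.assoc, Category.assoc, hU]
  have hconst := eq_const_of_idempotent hκ hε he hx (mulHom_self_of_left_eq x g rfl) hex
  -- Both maps give the same point of `E(S)`, which is a subscheme of `S`.
  have hπ : π = ε₀ ≫ κ := by
    apply SpecMap_fromSpecStalk_injective
    rw [← cancel_mono S.ιE, Spec.map_comp, Category.assoc (Spec.map κ), hε₀,
      Category.assoc (Spec.map κ), idempotentPoint_ιE]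
    exact congr($(hconst).left)
  have hmm : m ≤ m * m := by
    intro f hf
    rw [← pow_two, ← Ideal.Quotient.eq_zero_iff_mem]
    change π f = 0
    rw [hπ, CommRingCat.comp_apply, hε₀m f hf, map_zero]
  refine Submodule.eq_bot_of_le_smul_of_le_jacobson_bot m m (IsNoetherian.noetherian m) hmm ?_
  rw [IsLocalRing.jacobson_eq_maximalIdeal ⊥ bot_ne_top]

theorem isReducedAt_of_mem_centralizer [IsAlgClosed k] {e : S.Point} (he : IsIdempotentElem e)
    (hC : e ∈ Set.centralizer (C e)) : IsReducedAt e he := by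
  have := (IsLocalRing.isField_iff_maximalIdeal_eq (R := S.E.presheaf.stalk (toE e he))).mpr
    (maximalIdeal_stalk_E_eq_bot he hC)
  let := this.toField
  exact inferInstanceAs (_root_.IsReduced (S.E.presheaf.stalk (toE e he)))

theorem isIsolated_of_mem_centralizer [IsAlgClosed k] {e : S.Point} (he : IsIdempotentElem e)
    (hC : e ∈ Set.centralizer (C e)) : IsIsolated e he := by
  have hfield := (IsLocalRing.isField_iff_maximalIdeal_eq
    (R := S.E.presheaf.stalk (toE e he))).mpr (maximalIdeal_stalk_E_eq_bot he hC)
  -- No other point of `E(S)` specializes to `e`, as the local ring is a field.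
  have hgen (z : S.E) (hz : z ⤳ toE e he) : z = toE e he := by
    obtain ⟨p, rfl⟩ := (Scheme.range_fromSpecStalk (X := S.E) (x := toE e he)).ge hz
    have hp : p = IsLocalRing.closedPoint (S.E.presheaf.stalk (toE e he)) := by
      let := hfield.toField
      exact Subsingleton.elim (α := PrimeSpectrum (S.E.presheaf.stalk (toE e he))) _ _
    rw [hp, Scheme.fromSpecStalk_closedPoint]
  -- Hence the only irreducible component of `E(S)` through the closed point `e` is `{e}`.
  have hclosed : IsClosed {toE e he} := by
    have h1 : IsClosed {e.toSpace} := range_toSpace.le ⟨e, rfl⟩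
    convert h1.preimage S.ιE.continuous
    ext z
    rw [Set.mem_singleton_iff, Set.mem_preimage, Set.mem_singleton_iff, ← ιE_toE e he,
      S.ιE.isEmbedding.injective.eq_iff]
  obtain ⟨U, hU, heU, hUC⟩ := exists_isOpen_forall_mem_irreducibleComponents (toE e he)
  have : U = {toE e he} := by
    refine subset_antisymm (fun y hy ↦ ?_) (Set.singleton_subset_iff.mpr heU)
    have hZ := irreducibleComponent_mem_irreducibleComponents y
    have heZ := hUC y hy _ hZ mem_irreducibleComponent
    obtain ⟨z, hz⟩ := QuasiSober.sober (isIrreducible_irreducibleComponent (x := y))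
      (isClosed_of_mem_irreducibleComponents _ hZ)
    have hze : z = toE e he := hgen z (specializes_iff_mem_closure.mpr (hz.def.ge heZ))
    have := hz.def.ge (mem_irreducibleComponent (x := y))
    rwa [hze, hclosed.closure_eq] at this
  rw [IsIsolated, ← this]
  exact hU

end AlgebraicSemigroup

end

theorem mainTheorem4 {k : Type u} [Field k] [IsAlgClosed k] (S : AlgebraicSemigroup k) :
    (∀ (e : S.Point) (he : IsIdempotentElem e),
      (AlgebraicSemigroup.IsIsolated e he ↔
        e ∈ Set.centralizer (AlgebraicSemigroup.C e)) ∧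
      (AlgebraicSemigroup.IsIsolated e he → AlgebraicSemigroup.IsReducedAt e he)) ∧
    (IrreducibleSpace S.X.left →
      ∀ (e : S.Point) (he : IsIdempotentElem e),
        AlgebraicSemigroup.IsIsolated e he ↔ e ∈ Set.center S.Point) := by
  have h (e : S.Point) (he : IsIdempotentElem e) :
      AlgebraicSemigroup.IsIsolated e he ↔ e ∈ Set.centralizer (AlgebraicSemigroup.C e) :=
    ⟨AlgebraicSemigroup.mem_centralizer_of_isIsolated,
      AlgebraicSemigroup.isIsolated_of_mem_centralizer he⟩
  refine ⟨fun e he ↦ ⟨h e he, fun hi ↦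
    AlgebraicSemigroup.isReducedAt_of_mem_centralizer he ((h e he).mp hi)⟩, fun _ e he ↦ ?_⟩
  have hC : AlgebraicSemigroup.C e = Set.univ := Set.eq_univ_of_forall fun x ↦
    ⟨Set.univ, by rw [irreducibleComponents_eq_singleton]; rfl, trivial, trivial⟩
  rw [h, hC, Set.centralizer_univ]
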